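/- Let $N\ge 1$ be the number of rates and let $M\ge 1$ be the number of transmission success probability (TSP) classes. Let $0<\alpha\le 1$ be the packet arrival probability per slot and $\bar\alpha=1-\alpha$. Let $d,u\in[0,1]$ be the rate decrement and increment probabilities, not both $0$ if $N\ge 2$. For $m\in\{1,\dots,M\}$ and $n\in\{1,\dots,N\}$ let $p_{n,m}\in(0,1)$ be the probability that a fragment is delivered in a slot at rate $n$ in class $m$. At rate $n$ a packet consists of $n$ fragments. Put $d_n=d$ for $n<N$, $d_N=0$, $u_n=u$ for $n>1$, $u_1=0$. Fix a class $m$. The phases are the pairs $(n,i)$ with $1\le i\le n\le N$ (current rate $n$, fragment $i$ being transmitted). Let $\mathbf T_m$ and $\mathbf S_m$ be the matrices indexed by phases whose only nonzero entries are the following: - $\mathbf T_m[(n,1),(n,1)]=(1-d_n)(1-p_{n,m})$; $\ \mathbf T_m[(n,i),(n,i)]=1-p_{n,m}$ for $2\le i\le n$; $\ \mathbf T_m[(n,i),(n,i+1)]=p_{n,m}$ for $i<n$; $\ \mathbf T_m[(n,1),(n+1,1)]=d_n(1-p_{n,m})$ for $n<N$; - $\mathbf S_m[(n,n),(n,1)]=(1-u_n)p_{n,m}$;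 $\ \mathbf S_m[(n,n),(n-1,1)]=u_n\,p_{n,m}$ for $n>1$. Let $\mathbf E_m[(n,i),n']=\mathbf S_m[(n,i),(n',1)]$, and let $\mathbf C[n,(n',j)]=1$ if $n'=n$ and $j=1$, and $0$ otherwise. The dynamic rate-adaptation quasi-birth-death (QBD) chain of class $m$ has the states $(0,n)$ (empty buffer, next rate $n$) and $(k,(n,i))$ with $k\ge1$ packets in the buffer, and the block transition matrix $$\mathbf P=\begin{bmatrix}\bar\alpha\mathbf I&\alpha\mathbf C&&&\\ \bar\alpha\mathbf E_m&\mathbf A_1&\mathbf A_0&&\\ &\mathbf A_2&\mathbf A_1&\mathbf A_0&\\ &&\ddots&\ddots&\ddots\end{bmatrix},\qquad \mathbf A_0=\alpha\mathbf T_m,\quad \mathbf A_1=\bar\alpha\mathbf T_m+\alpha\mathbf S_m,\quad \mathbf A_2=\bar\alpha\mathbf S_m .$$ The chain is called stable if it has a positive recurrent state that is reached from every state in finite mean time (for an irreducible chain: if it is positive recurrent). With $\mathbf e$ the column vector of ones, the matrix $[\mathbf S_m+\mathbf T_m]^T-\mathbf I+\mathbf e\mathbf e^T$ is invertible, and $$\mathbf\Pi_m=\big([\mathbf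 S_m+\mathbf T_m]^T-\mathbf I+\mathbf e\mathbf e^T\big)^{-1}\mathbf e ,$$ read as a row vector, is nonnegative and is the unique solution of $\mathbf\Pi_m\mathbf A=\mathbf\Pi_m$, $\mathbf\Pi_m\mathbf e=1$, where $\mathbf A=\mathbf A_0+\mathbf A_1+\mathbf A_2$. The chain is stable if and only if $$\bar\alpha\,\mathbf\Pi_m\mathbf S_m\mathbf e>\alpha\,\mathbf\Pi_m\mathbf T_m\mathbf e .$$ -/

import Mathlib

open scoped ENNReal Matrix

namespace RateQBD

noncomputable section

/-! ### Stability of a Markov chain on a discrete state space -/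

/-- `firstPassage P x k y` is the probability that the chain with transition matrix `P`, started
in `y` at time `0`, visits `x` for the first time after time `0` exactly at time `k`. -/
def firstPassage {X : Type*} (P : Matrix X X ℝ) (x : X) : ℕ → X → ℝ≥0∞
  | 0, _ => 0
  | 1, y => ENNReal.ofReal (P y x)
  | k + 2, y => ∑' z : {z : X // z ≠ x}, ENNReal.ofReal (P y z) * firstPassage P x (k + 1) z

/-- Started in `y`, the chain visits `x` at some positive time almost surely, and the mean of the
first such time is finite. For `y = x` this says that `x` is positive recurrent. -/
def FiniteMeanPassage {X : Type*} (P : Matrix X X ℝ) (y x : X) : Prop :=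
  ∑' k : ℕ, firstPassage P x k y = 1 ∧ ∑' k : ℕ, (k : ℝ≥0∞) * firstPassage P x k y < ∞

/-- Stability (positive recurrence): some state is positive recurrent and is reached from every
state in finite mean time. For an irreducible chain this is positive recurrence in the usual sense;
in general it says that there is exactly one recurrent class, that this class is positive
recurrent, and that it is entered in finite mean time from every (transient) state. -/
def Stable {X : Type*} (P : Matrix X X ℝ) : Prop :=
  ∃ x : X, FiniteMeanPassage P x x ∧ ∀ y : X, FiniteMeanPassage P y x

/-! ### Phases and blocks

Rates are numbered from zero: `n : Fin N` is the rate that splits a packet into `n + 1` fragments,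
so that `n + 1` is the next lower rate. The argument `p n` is the probability that the transmission
of one fragment at rate `n` succeeds, `d` and `u` are the decrement and increment probabilities. -/

/-- A phase: the current rate `n` and the index (from zero) of the fragment being transmitted. -/
abbrev Phase (N : ℕ) : Type := Σ n : Fin N, Fin (n.val + 1)

/-- Decrement probability at rate `n`: there is no rate below the last one. -/
def dec {N : ℕ} (d : ℝ) (n : Fin N) : ℝ := if n.val + 1 < N then d else 0

/-- Increment probability at rate `n`: there is no rate above the first one. -/
def inc {N : ℕ} (u : ℝ) (n : Fin N) : ℝ := if 0 < n.val then u else 0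

/-- Transmissions at a rate with success probability `q` and decrement probability `δ` that neither
finish the packet nor change the rate. -/
def blockF (a b : ℕ) (δ q : ℝ) : Matrix (Fin a) (Fin b) ℝ := fun i j =>
  if j.val = i.val then (if i.val = 0 then (1 - δ) * (1 - q) else 1 - q)
  else if j.val = i.val + 1 then q
  else 0

/-- Failure of the first fragment, followed by a change to the next lower rate. -/
def blockD (a b : ℕ) (δ q : ℝ) : Matrix (Fin a) (Fin b) ℝ := fun i j =>
  if i.val = 0 ∧ j.val = 0 then δ * (1 - q) else 0

/-- Success of the last fragment, the next packet being sent at the next higher rate. -/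
def blockU (a b : ℕ) (υ q : ℝ) : Matrix (Fin a) (Fin b) ℝ := fun i j =>
  if i.val + 1 = a ∧ j.val = 0 then υ * q else 0

/-- Success of the last fragment, the next packet being sent at the same rate. -/
def blockM (a b : ℕ) (υ q : ℝ) : Matrix (Fin a) (Fin b) ℝ := fun i j =>
  if i.val + 1 = a ∧ j.val = 0 then (1 - υ) * q else 0

/-- Phase transitions without the delivery of a packet: block upper bidiagonal with diagonal
blocks `F` and superdiagonal blocks `D`. -/
def T {N : ℕ} (d : ℝ) (p : Fin N → ℝ) : Matrix (Phase N) (Phase N) ℝ := fun x y =>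
  if y.1.val = x.1.val then blockF _ _ (dec d x.1) (p x.1) x.2 y.2
  else if y.1.val = x.1.val + 1 then blockD _ _ (dec d x.1) (p x.1) x.2 y.2
  else 0

/-- Phase transitions with the delivery of a packet: block lower bidiagonal with diagonal
blocks `M` and subdiagonal blocks `U`. -/
def S {N : ℕ} (u : ℝ) (p : Fin N → ℝ) : Matrix (Phase N) (Phase N) ℝ := fun x y =>
  if y.1.val = x.1.val then blockM _ _ (inc u x.1) (p x.1) x.2 y.2
  else if y.1.val + 1 = x.1.val then blockU _ _ (inc u x.1) (p x.1) x.2 y.2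
  else 0

/-- Delivery of the only packet in the buffer; an idle transmitter remembers the rate that it will
use next. The block `(n, n')` is the first column of the block `(n, n')` of `S`. -/
def E {N : ℕ} (u : ℝ) (p : Fin N → ℝ) : Matrix (Phase N) (Fin N) ℝ := fun x n =>
  S u p x ⟨n, 0⟩

/-- A packet that finds the buffer empty starts with its first fragment at the remembered rate. -/
def C (N : ℕ) : Matrix (Fin N) (Phase N) ℝ := fun n y =>
  if y.1 = n ∧ y.2.val = 0 then 1 else 0

/-! ### The quasi-birth-death chain -/

def A0 {N : ℕ} (α d : ℝ) (p : Fin N → ℝ) : Matrix (Phase N) (Phase N) ℝ :=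
  α • T d p

def A1 {N : ℕ} (α d u : ℝ) (p : Fin N → ℝ) : Matrix (Phase N) (Phase N) ℝ :=
  (1 - α) • T d p + α • S u p

def A2 {N : ℕ} (α u : ℝ) (p : Fin N → ℝ) : Matrix (Phase N) (Phase N) ℝ :=
  (1 - α) • S u p

/-- The transition matrix of the phase process. -/
def A {N : ℕ} (α d u : ℝ) (p : Fin N → ℝ) : Matrix (Phase N) (Phase N) ℝ :=
  A0 α d p + A1 α d u p + A2 α u p

/-- States: `idle n` is the empty buffer with remembered rate `n`; `busy k x` is a buffer with
`k + 1` packets in phase `x`. -/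
inductive State (N : ℕ) : Type
  | idle (n : Fin N) : State N
  | busy (k : ℕ) (x : Phase N) : State N

/-- The block tridiagonal transition matrix; a packet arrives in each slot with probability `α`. -/
def P {N : ℕ} (α d u : ℝ) (p : Fin N → ℝ) : Matrix (State N) (State N) ℝ
  | .idle n, .idle n' => ((1 - α) • (1 : Matrix (Fin N) (Fin N) ℝ)) n n'
  | .idle n, .busy l y => if l = 0 then (α • C N) n y else 0
  | .busy k x, .idle n => if k = 0 then ((1 - α) • E u p) x n else 0
  | .busy k x, .busy l y =>
      if l = k + 1 then A0 α d p x y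
      else if l = k then A1 α d u p x y
      else if l + 1 = k then A2 α u p x y
      else 0

/-- `((S + T)ᵀ - I + e eᵀ)`, with `e` the vector of ones. -/
def K {N : ℕ} (d u : ℝ) (p : Fin N → ℝ) : Matrix (Phase N) (Phase N) ℝ :=
  (S u p + T d p)ᵀ - 1 + Matrix.vecMulVec 1 1

/-- `((S + T)ᵀ - I + e eᵀ)⁻¹ e`. -/
def stat {N : ℕ} (d u : ℝ) (p : Fin N → ℝ) : Phase N → ℝ :=
  (K d u p)⁻¹ *ᵥ 1

end

end RateQBD

/-! Let `c` be the stationary mean of `S e`, the delivery probability per slot. Since `S + T` is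
stochastic, the stationary mean of `T e` is `1 - c`, and the criterion reads `α < c`. The phase
chain has a state reachable from every phase, so harmonic functions are constant. This makes `K`
invertible and the Poisson equation `(S + T) h - h = S e - c` solvable (`exists_poisson`). The
potential "number of packets plus `h`" then has exact mean drift `α - c` in every busy state,
boundary level included, and `α` in every idle state.

If `α < c`, the drift is negative outside the finite set of idle states, and Foster–Lyapunov
(`finiteMeanPassage_of_drift`) gives finite mean passage to a fixed state. If `c ≤ α`, the potential
is a submartingale with bounded upward increments. Optional stopping (`le_of_subharmonic`) would
bound it by its value at the recurrent state, but it is unbounded. -/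

namespace RateQBD

open Filter Topology

/-! ### First passage times, the Foster–Lyapunov criterion and optional stopping -/

section General

variable {X : Type*} {P : Matrix X X ℝ} {x : X}

/-- The transition operator of the chain that is killed when it enters `x`. -/
noncomputable def taboo (P : Matrix X X ℝ) (x : X) (f : X → ℝ≥0∞) (y : X) : ℝ≥0∞ :=
  ∑' z : {z : X // z ≠ x}, ENNReal.ofReal (P y z) * f z

/-- The probability that the chain started in `y` does not visit `x` at the times `1, …, n`. -/
noncomputable def survival (P : Matrix X X ℝ) (x : X) : ℕ → X → ℝ≥0∞
  | 0 => 1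
  | n + 1 => taboo P x (survival P x n)

theorem taboo_mono {f g : X → ℝ≥0∞} (h : ∀ z, f z ≤ g z) (y : X) :
    taboo P x f y ≤ taboo P x g y :=
  ENNReal.tsum_le_tsum fun z => mul_le_mul_right (h z) _

theorem taboo_add (f g : X → ℝ≥0∞) (y : X) :
    taboo P x (fun z => f z + g z) y = taboo P x f y + taboo P x g y := by
  simp only [taboo, mul_add, ENNReal.tsum_add]

theorem taboo_const_mul (c : ℝ≥0∞) (f : X → ℝ≥0∞) (y : X) :
    taboo P x (fun z => c * f z) y = c * taboo P x f y := by
  simp only [taboo, ← ENNReal.tsum_mul_left]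
  exact tsum_congr fun z => by ring

theorem tsum_eq_add_taboo (f : X → ℝ≥0∞) (y : X) :
    ∑' z, ENNReal.ofReal (P y z) * f z = ENNReal.ofReal (P y x) * f x + taboo P x f y := by
  classical
  rw [ENNReal.tsum_eq_add_tsum_ite x, taboo]
  congr 1
  rw [← tsum_subtype_eq_of_support_subset (s := {z | z ≠ x})]
  · refine tsum_congr fun z => ?_
    rw [if_neg z.2]
  · intro z hz
    by_contra h
    simp only [Set.mem_ofPred_eq, not_not] at h
    simp [h] at hz

theorem taboo_le_tsum (f : X → ℝ≥0∞) (y : X) :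
    taboo P x f y ≤ ∑' z, ENNReal.ofReal (P y z) * f z := by
  rw [tsum_eq_add_taboo (x := x)]
  exact le_add_self

theorem firstPassage_add_two (k : ℕ) (y : X) :
    firstPassage P x (k + 2) y = taboo P x (firstPassage P x (k + 1)) y := by
  rw [firstPassage, taboo]

theorem firstPassage_add_survival (h1 : ∀ y, ∑' z, ENNReal.ofReal (P y z) = 1) (n : ℕ) (y : X) :
    firstPassage P x (n + 1) y + survival P x (n + 1) y = survival P x n y := by
  induction n generalizing y with
  | zero =>
    have := tsum_eq_add_taboo (P := P) (x := x) 1 y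
    simp only [Pi.one_apply, mul_one, h1] at this
    simp only [firstPassage, survival, Pi.one_apply]
    exact this.symm
  | succ n ih =>
    rw [firstPassage_add_two, survival, ← taboo_add, survival]
    congr 1
    exact funext ih

theorem survival_le_one (h1 : ∀ y, ∑' z, ENNReal.ofReal (P y z) = 1) (n : ℕ) (y : X) :
    survival P x n y ≤ 1 := by
  induction n with
  | zero => simp [survival]
  | succ n ih =>
    rw [← firstPassage_add_survival h1] at ih
    exact le_add_self.trans ih

theorem survival_antitone (h1 : ∀ y, ∑' z, ENNReal.ofReal (P y z) = 1) (y : X) :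
    Antitone fun n => survival P x n y :=
  antitone_nat_of_succ_le fun n => by
    rw [← firstPassage_add_survival h1 n]
    exact le_add_self

theorem sum_firstPassage_add_survival (h1 : ∀ y, ∑' z, ENNReal.ofReal (P y z) = 1) (n : ℕ)
    (y : X) : ∑ k ∈ Finset.range (n + 1), firstPassage P x k y + survival P x n y = 1 := by
  induction n with
  | zero => simp [firstPassage, survival]
  | succ n ih =>
    rw [Finset.sum_range_succ, add_assoc, firstPassage_add_survival h1, ih]

/-- Abel summation for `E τ = ∑ P(τ > k)`, truncated at `n` so that no subtraction occurs in `ℝ≥0∞`.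
-/
theorem sum_mul_firstPassage_add (h1 : ∀ y, ∑' z, ENNReal.ofReal (P y z) = 1) (n : ℕ) (y : X) :
    ∑ k ∈ Finset.range (n + 1), (k : ℝ≥0∞) * firstPassage P x k y + n * survival P x n y =
      ∑ k ∈ Finset.range n, survival P x k y := by
  induction n with
  | zero => simp [firstPassage]
  | succ n ih =>
    rw [Finset.sum_range_succ, add_assoc, ← mul_add, firstPassage_add_survival h1,
      Finset.sum_range_succ (fun k => survival P x k y), ← ih]
    push_cast
    ring

theorem finiteMeanPassage_of_tsum_survival (h1 : ∀ y, ∑' z, ENNReal.ofReal (P y z) = 1) (y : X)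
    (h : ∑' k, survival P x k y ≠ ∞) : FiniteMeanPassage P y x := by
  have h0 := ENNReal.tendsto_atTop_zero_of_tsum_ne_top h
  constructor
  · have hs := ((ENNReal.summable (f := fun k => firstPassage P x k y)).hasSum.tendsto_sum_nat.comp
      (tendsto_add_atTop_nat 1)).add h0
    have : Tendsto (fun _ : ℕ => (1 : ℝ≥0∞)) atTop (𝓝 (∑' k, firstPassage P x k y + 0)) :=
      hs.congr fun n => sum_firstPassage_add_survival h1 n y
    rw [add_zero] at this
    exact (tendsto_nhds_unique tendsto_const_nhds this).symm
  · refine lt_of_le_of_lt (ENNReal.tsum_le_of_sum_range_le fun n => ?_) h.lt_top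
    calc ∑ k ∈ Finset.range n, (k : ℝ≥0∞) * firstPassage P x k y
        ≤ ∑ k ∈ Finset.range (n + 1), (k : ℝ≥0∞) * firstPassage P x k y :=
          Finset.sum_le_sum_of_subset (Finset.range_mono n.le_succ)
      _ ≤ ∑ k ∈ Finset.range n, survival P x k y := by
          rw [← sum_mul_firstPassage_add h1]
          exact le_self_add
      _ ≤ _ := ENNReal.sum_le_tsum _

/-- Iterating `W ≥ Q W + ε` for the killed operator `Q` gives `W ≥ ε (1 + Q 1 + Q² 1 + ⋯)`, and `Qᵏ
1` is the survival probability. -/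
theorem sum_survival_le_of_drift {W : X → ℝ≥0∞} {ε : ℝ≥0∞}
    (hW : ∀ y, taboo P x W y + ε ≤ W y) (n : ℕ) (y : X) :
    ε * ∑ k ∈ Finset.range n, survival P x k y ≤ W y := by
  induction n generalizing y with
  | zero => simp
  | succ n ih =>
    refine le_trans ?_ (hW y)
    rw [Finset.sum_range_succ', mul_add]
    refine add_le_add ?_ (by simp [survival])
    refine le_trans ?_ (taboo_mono ih y)
    rw [taboo_const_mul]
    gcongr
    clear ih hW
    induction n with
    | zero => simp
    | succ n ih =>
      simp only [Finset.sum_range_succ, taboo_add]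
      exact add_le_add ih le_rfl

/-- The Foster–Lyapunov criterion with a finite exceptional set `F` from which `x` is reachable. -/
theorem finiteMeanPassage_of_drift (h1 : ∀ y, ∑' z, ENNReal.ofReal (P y z) = 1)
    {V : X → ℝ≥0∞} (hV : ∀ y, V y ≠ ∞) {ε b : ℝ≥0∞} (hε : ε ≠ 0) (hb : b ≠ ∞) (F : Finset X)
    (hF : ∀ y ∈ F, ∃ k, firstPassage P x k y ≠ 0)
    (hin : ∀ y ∈ F, ∑' z, ENNReal.ofReal (P y z) * V z + ε ≤ V y + b)
    (hout : ∀ y ∉ F, ∑' z, ENNReal.ofReal (P y z) * V z + ε ≤ V y) (y : X) :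
    FiniteMeanPassage P y x := by
  classical
  have hlt : ∀ y ∈ F, ∃ k, survival P x k y < 1 := by
    intro y hy
    obtain ⟨k, hk⟩ := hF y hy
    rcases k with _ | k
    · simp [firstPassage] at hk
    refine ⟨k + 1, ?_⟩
    refine lt_of_lt_of_le ?_ (survival_le_one (x := x) h1 k y)
    rw [← firstPassage_add_survival h1 k, add_comm (firstPassage P x (k + 1) y)]
    exact ENNReal.lt_add_right
      ((survival_le_one (x := x) h1 (k + 1) y).trans_lt ENNReal.one_lt_top).ne hk
  -- One horizon serves all of `F`: it is finite and survival decreases in time.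
  have hL : ∃ L, ∀ y ∈ F, survival P x L y < 1 := by
    choose! l hl using hlt
    exact ⟨F.sup l, fun y hy =>
      (survival_antitone h1 y (Finset.le_sup (f := l) hy)).trans_lt (hl y hy)⟩
  obtain ⟨L, hL⟩ := hL
  -- Large enough that `c (1 - survival L) ≥ b` on `F`: this gain pays for the excess `b` there.
  set c : ℝ≥0∞ := ∑ y ∈ F, b / (1 - survival P x L y) with hc
  have hctop : c ≠ ∞ := by
    refine (ENNReal.sum_lt_top.2 fun y hy => ?_).ne
    exact ENNReal.div_lt_top hb (tsub_pos_of_lt (hL y hy)).ne'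
  have hcb : ∀ y ∈ F, b + c * survival P x L y ≤ c := by
    intro y hy
    have h2 : b ≤ c * (1 - survival P x L y) := by
      rw [← ENNReal.div_le_iff_le_mul (Or.inl (tsub_pos_of_lt (hL y hy)).ne')
        (Or.inl (ENNReal.sub_ne_top ENNReal.one_ne_top))]
      exact Finset.single_le_sum (f := fun y => b / (1 - survival P x L y))
        (fun _ _ => zero_le) hy
    calc b + c * survival P x L y ≤ c * (1 - survival P x L y) + c * survival P x L y := by gcongr
      _ = c := by rw [← mul_add, tsub_add_cancel_of_le (hL y hy).le, mul_one]
  -- `G` is the mean of `min(τ, L)`. The killed operator lowers it by `1 - survival L`, which is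
  -- nonnegative everywhere and positive on `F`, so `V + c G` has drift at most `-ε` everywhere.
  let G : X → ℝ≥0∞ := fun y => ∑ k ∈ Finset.range L, survival P x k y
  have hG : ∀ y, taboo P x G y + 1 = G y + survival P x L y := by
    intro y
    have : ∀ n, taboo P x (fun y => ∑ k ∈ Finset.range n, survival P x k y) y =
        ∑ k ∈ Finset.range n, survival P x (k + 1) y := by
      intro n
      induction n with
      | zero => simp [taboo]
      | succ n ih =>
        simp only [Finset.sum_range_succ, taboo_add, ih]
        rfl
    rw [this L, ← Finset.sum_range_succ, Finset.sum_range_succ']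
    simp [survival]
  have hGtop : ∀ y, G y ≠ ∞ := fun y =>
    (ENNReal.sum_lt_top.2 fun k _ => (survival_le_one h1 k y).trans_lt ENNReal.one_lt_top).ne
  have hW : ∀ y, taboo P x (fun z => V z + c * G z) y + ε ≤ V y + c * G y := by
    intro y
    rw [taboo_add, taboo_const_mul]
    have key : taboo P x V y + ε + (c * G y + c * survival P x L y) ≤ V y + c * G y + c := by
      by_cases hy : y ∈ F
      · calc _ ≤ V y + b + (c * G y + c * survival P x L y) :=
              add_le_add ((add_le_add (taboo_le_tsum V y) le_rfl).trans (hin y hy)) le_rfl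
          _ = V y + c * G y + (b + c * survival P x L y) := by ring
          _ ≤ _ := add_le_add le_rfl (hcb y hy)
      · calc _ ≤ V y + (c * G y + c * 1) :=
              add_le_add ((add_le_add (taboo_le_tsum V y) le_rfl).trans (hout y hy))
                (add_le_add le_rfl (mul_le_mul_right (survival_le_one h1 L y) _))
          _ = _ := by ring
    rw [← mul_add, ← hG y] at key
    refine (ENNReal.add_le_add_iff_right hctop).1 (le_trans (le_of_eq ?_) key)
    ring
  refine finiteMeanPassage_of_tsum_survival h1 y ?_
  have hle : ∑' k, survival P x k y ≤ (V y + c * G y) / ε := by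
    refine ENNReal.tsum_le_of_sum_range_le fun n => ?_
    have hWtop : V y + c * G y ≠ ∞ := ENNReal.add_ne_top.2 ⟨hV y, ENNReal.mul_ne_top hctop (hGtop y)⟩
    rw [ENNReal.le_div_iff_mul_le (Or.inl hε) (Or.inr hWtop), mul_comm]
    exact sum_survival_le_of_drift hW n y
  refine (hle.trans_lt (ENNReal.div_lt_top ?_ hε)).ne
  exact ENNReal.add_ne_top.2 ⟨hV y, ENNReal.mul_ne_top hctop (hGtop y)⟩

theorem exists_firstPassage_ne_zero_of_step {y z : X} (hyz : 0 < P y z)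
    (hz : z = x ∨ ∃ k, firstPassage P x k z ≠ 0) : ∃ k, firstPassage P x k y ≠ 0 := by
  by_cases hzx : z = x
  · subst hzx
    exact ⟨1, by simpa [firstPassage] using hyz⟩
  · obtain ⟨k, hk⟩ := hz.resolve_left hzx
    rcases k with _ | k
    · simp [firstPassage] at hk
    refine ⟨k + 2, ?_⟩
    rw [firstPassage_add_two]
    have := ENNReal.le_tsum (f := fun z : {z : X // z ≠ x} =>
      ENNReal.ofReal (P y z) * firstPassage P x (k + 1) z) ⟨z, hzx⟩
    refine (lt_of_lt_of_le ?_ this).ne'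
    exact ENNReal.mul_pos (ENNReal.ofReal_pos.2 hyz).ne' hk

theorem exists_firstPassage_ne_zero {y : X}
    (h : Relation.TransGen (fun a b => 0 < P a b) y x) : ∃ k, firstPassage P x k y ≠ 0 := by
  induction h using Relation.TransGen.head_induction_on with
  | single h => exact exists_firstPassage_ne_zero_of_step h (Or.inl rfl)
  | head h _ ih => exact exists_firstPassage_ne_zero_of_step h (Or.inr ih)

/-- Markov's inequality on the tail: `n P(τ > n) ≤ ∑_{k > n} k P(τ = k)`, the remainder of a
convergent series. -/
theorem tendsto_mul_survival (h1 : ∀ y, ∑' z, ENNReal.ofReal (P y z) = 1) {y : X}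
    (h : FiniteMeanPassage P y x) :
    Tendsto (fun n : ℕ => (n : ℝ≥0∞) * survival P x n y) atTop (𝓝 0) ∧
      Tendsto (fun n : ℕ => survival P x n y) atTop (𝓝 0) := by
  obtain ⟨hs, hm⟩ := h
  have htail : ∀ n, survival P x n y = ∑' k, firstPassage P x (k + (n + 1)) y := by
    intro n
    have e := sum_firstPassage_add_survival (x := x) h1 n y
    rw [← hs, ← ENNReal.summable.sum_add_tsum_nat_add' (f := fun k => firstPassage P x k y)
      (k := n + 1)] at e
    refine (ENNReal.add_right_inj ?_).1 e
    refine ((ENNReal.sum_le_tsum _).trans_lt ?_).ne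
    rw [hs]
    exact ENNReal.one_lt_top
  have key : Tendsto (fun n : ℕ => (n : ℝ≥0∞) * survival P x n y) atTop (𝓝 0) := by
    have h0 := (ENNReal.tendsto_sum_nat_add (fun k : ℕ => (k : ℝ≥0∞) * firstPassage P x k y)
      hm.ne).comp (tendsto_add_atTop_nat 1)
    refine tendsto_of_tendsto_of_tendsto_of_le_of_le tendsto_const_nhds h0 (fun _ => zero_le)
      fun n => ?_
    simp only [Function.comp]
    rw [htail, ← ENNReal.tsum_mul_left]
    refine ENNReal.tsum_le_tsum fun k => ?_
    gcongr
    omega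
  refine ⟨key, tendsto_of_tendsto_of_tendsto_of_le_of_le' tendsto_const_nhds key
    (Eventually.of_forall fun _ => zero_le) ?_⟩
  filter_upwards [eventually_ge_atTop 1] with n hn
  calc survival P x n y = 1 * survival P x n y := (one_mul _).symm
    _ ≤ n * survival P x n y := by
      gcongr
      exact_mod_cast hn

/-- A nonnegative subharmonic function with bounded upward increments that vanishes at `x` vanishes
wherever `x` is reached in finite mean time. -/
theorem eq_zero_of_subharmonic (h1 : ∀ y, ∑' z, ENNReal.ofReal (P y z) = 1) {W : X → ℝ≥0∞}
    {B : ℝ≥0∞} (hB : B ≠ ∞) (hinc : ∀ y z, 0 < P y z → W z ≤ W y + B) (hx : W x = 0)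
    (hW : ∀ y, W y ≤ ∑' z, ENNReal.ofReal (P y z) * W z) {y : X} (hy : W y ≠ ∞)
    (h : FiniteMeanPassage P y x) : W y = 0 := by
  have hQ : ∀ y, W y ≤ taboo P x W y := fun y => by
    simpa [tsum_eq_add_taboo (x := x), hx] using hW y
  -- Iterate `W ≤ Q W` for the killed operator `Q`: a path surviving `n` steps has raised `W` by at
  -- most `n B`.
  have main : ∀ (n : ℕ) (y : X), W y ≤ (W y + n * B) * survival P x n y := by
    intro n
    induction n with
    | zero => simp [survival]
    | succ n ih =>
      intro y
      calc W y ≤ taboo P x W y := hQ y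
        _ ≤ taboo P x (fun z => (W z + n * B) * survival P x n z) y := taboo_mono ih y
        _ ≤ taboo P x (fun z => (W y + (n + 1 : ℕ) * B) * survival P x n z) y := by
          refine ENNReal.tsum_le_tsum fun z => ?_
          rcases le_or_gt (P y z) 0 with hz | hz
          · simp [ENNReal.ofReal_of_nonpos hz]
          · refine mul_le_mul_right (mul_le_mul_left ?_ _) _
            calc W z + n * B ≤ W y + B + n * B := by gcongr; exact hinc y z hz
              _ = _ := by push_cast; ring
        _ = _ := by rw [taboo_const_mul]; rfl
  obtain ⟨hn, hs⟩ := tendsto_mul_survival h1 h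
  have hlim : Tendsto (fun n : ℕ => (W y + n * B) * survival P x n y) atTop (𝓝 0) := by
    have := (ENNReal.Tendsto.const_mul hs (Or.inr hy)).add (ENNReal.Tendsto.const_mul hn (Or.inr hB))
    simp only [mul_zero, add_zero] at this
    exact this.congr fun n => by ring
  exact le_antisymm (ge_of_tendsto' hlim fun n => main n y) zero_le

/-- The positive part of a sum is at most the sum of the positive parts; this carries subharmonicity
over to positive parts. -/
theorem ofReal_le_tsum_ofReal {f : X → ℝ} {a : ℝ} (h : HasSum f a) :
    ENNReal.ofReal a ≤ ∑' z, ENNReal.ofReal (f z) := by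
  have hs : Summable fun z => max (f z) 0 := by
    refine Summable.of_nonneg_of_le (fun z => le_max_right _ _) (fun z => ?_) h.summable.abs
    exact max_le (le_abs_self _) (abs_nonneg _)
  calc ENNReal.ofReal a ≤ ENNReal.ofReal (∑' z, max (f z) 0) := by
        refine ENNReal.ofReal_le_ofReal ?_
        rw [← h.tsum_eq]
        exact h.summable.tsum_le_tsum (fun z => le_max_left _ _) hs
    _ = ∑' z, ENNReal.ofReal (f z) := by
        rw [ENNReal.ofReal_tsum_of_nonneg (fun z => le_max_right _ _) hs]
        refine tsum_congr fun z => ?_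
        rcases le_total (f z) 0 with h0 | h0
        · simp [h0, ENNReal.ofReal_of_nonpos h0]
        · simp [h0]

theorem tsum_ofReal_eq_one (h0 : ∀ y z, 0 ≤ P y z) (h1 : ∀ y, HasSum (P y) 1) (y : X) :
    ∑' z, ENNReal.ofReal (P y z) = 1 := by
  rw [← ENNReal.ofReal_tsum_of_nonneg (h0 y) (h1 y).summable, (h1 y).tsum_eq, ENNReal.ofReal_one]

/-- Optional stopping: a submartingale with bounded upward increments is at most its value at a
state that is reached in finite mean time. -/
theorem le_of_subharmonic (h0 : ∀ y z, 0 ≤ P y z) (h1 : ∀ y, HasSum (P y) 1) {V : X → ℝ} {B : ℝ}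
    (hinc : ∀ y z, 0 < P y z → V z ≤ V y + B) {v : X → ℝ}
    (hv : ∀ y, HasSum (fun z => P y z * V z) (v y)) (hV : ∀ y, V y ≤ v y) {y : X}
    (h : FiniteMeanPassage P y x) : V y ≤ V x := by
  -- The positive part of `V - V x` is subharmonic and vanishes at `x`.
  have := eq_zero_of_subharmonic (tsum_ofReal_eq_one h0 h1)
    (W := fun z => ENNReal.ofReal (V z - V x)) (B := ENNReal.ofReal B) ENNReal.ofReal_ne_top
    (fun y z hyz => ?_) (by simp) (fun y => ?_) ENNReal.ofReal_ne_top h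
  · rw [ENNReal.ofReal_eq_zero] at this
    linarith
  · refine (ENNReal.ofReal_le_ofReal ?_).trans ENNReal.ofReal_add_le
    linarith [hinc y z hyz]
  · have hs : HasSum (fun z => P y z * (V z - V x)) (v y - 1 * V x) := by
      simpa only [mul_sub] using (hv y).sub ((h1 y).mul_right (V x))
    refine le_trans (ENNReal.ofReal_le_ofReal ?_) ((ofReal_le_tsum_ofReal hs).trans_eq ?_)
    · linarith [hV y]
    · exact tsum_congr fun z => ENNReal.ofReal_mul (h0 y z)

end General

/-! ### Finite stochastic matrices: maximum principle, stationary vector, Poisson equation -/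

section Finite

variable {ι : Type*} [Fintype ι] {A : Matrix ι ι ℝ} {x₀ : ι}

/-- An average that reaches the maximum gives no weight to smaller values. -/
theorem apply_eq_of_isMax_of_le_mulVec (h0 : ∀ x y, 0 ≤ A x y) (h1 : A *ᵥ 1 = 1) {h : ι → ℝ}
    {x y : ι} (hx : ∀ z, h z ≤ h x) (hA : h x ≤ (A *ᵥ h) x) (hxy : 0 < A x y) : h y = h x := by
  have hsum : ∑ z, A x z = 1 := by
    simpa [Matrix.mulVec, dotProduct] using congrFun h1 x
  have hn : ∀ z ∈ Finset.univ, 0 ≤ A x z * (h x - h z) := fun z _ =>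
    mul_nonneg (h0 x z) (sub_nonneg.2 (hx z))
  have hz : ∑ z, A x z * (h x - h z) = 0 := by
    refine le_antisymm ?_ (Finset.sum_nonneg hn)
    simp only [mul_sub, Finset.sum_sub_distrib, ← Finset.sum_mul, hsum]
    simp only [Matrix.mulVec, dotProduct] at hA
    linarith
  have := (Finset.sum_eq_zero_iff_of_nonneg hn).1 hz y (Finset.mem_univ y)
  rcases mul_eq_zero.1 this with h | h
  · exact absurd h hxy.ne'
  · linarith

/-- The maximum principle for a chain in which `x₀` is reachable from every state. -/
theorem le_apply_of_subharmonic (h0 : ∀ x y, 0 ≤ A x y) (h1 : A *ᵥ 1 = 1)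
    (hr : ∀ x, Relation.ReflTransGen (fun a b => 0 < A a b) x x₀) {h : ι → ℝ}
    (hA : ∀ x, h x ≤ (A *ᵥ h) x) (y : ι) : h y ≤ h x₀ := by
  have : Nonempty ι := ⟨x₀⟩
  obtain ⟨x, hx⟩ := Finite.exists_max h
  have : h x₀ = h x := by
    have hrx := hr x
    clear hr
    induction hrx with
    | refl => rfl
    | @tail b c _ hbc ih =>
      rw [← ih]
      exact apply_eq_of_isMax_of_le_mulVec h0 h1 (fun z => ih ▸ hx z) (hA b) hbc
  exact this ▸ hx y

theorem eq_const_of_harmonic (h0 : ∀ x y, 0 ≤ A x y) (h1 : A *ᵥ 1 = 1)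
    (hr : ∀ x, Relation.ReflTransGen (fun a b => 0 < A a b) x x₀) {h : ι → ℝ}
    (hA : A *ᵥ h = h) (y : ι) : h y = h x₀ := by
  refine le_antisymm (le_apply_of_subharmonic h0 h1 hr (fun x => (congrFun hA x).ge) y) ?_
  have := le_apply_of_subharmonic h0 h1 hr (h := -h)
    (fun x => by rw [Matrix.mulVec_neg, hA]) y
  simpa using this

/-- By the triangle inequality `|w| ≤ |w| A` entrywise. Both sides have the same total mass, so
`|w|` is invariant, and uniqueness identifies `w` with its normalization. -/
theorem stationary_nonneg (h0 : ∀ x y, 0 ≤ A x y) (h1 : A *ᵥ 1 = 1) {w : ι → ℝ}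
    (hw : ∀ v : ι → ℝ, (v ᵥ* A = v ∧ v ⬝ᵥ 1 = 1) ↔ v = w) (x : ι) : 0 ≤ w x := by
  obtain ⟨hA, hs⟩ := (hw w).2 rfl
  set a : ι → ℝ := fun x => |w x| with ha
  have hle : ∀ y ∈ Finset.univ, a y ≤ (a ᵥ* A) y := by
    intro y _
    calc a y = |(w ᵥ* A) y| := by rw [hA]
      _ ≤ ∑ z, |w z * A z y| := Finset.abs_sum_le_sum_abs _ _
      _ = (a ᵥ* A) y := Finset.sum_congr rfl fun z _ => by rw [abs_mul, abs_of_nonneg (h0 z y)]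
  have htot : ∑ y, a y = ∑ y, (a ᵥ* A) y := by
    have := Matrix.dotProduct_mulVec a A 1
    rw [h1] at this
    simpa [dotProduct] using this
  have haA : a ᵥ* A = a :=
    funext fun y => ((Finset.sum_eq_sum_iff_of_le hle).1 htot y (Finset.mem_univ y)).symm
  have hpos : 0 < ∑ y, a y := by
    have : (1 : ℝ) ≤ ∑ y, a y := by
      rw [← hs]
      simpa [dotProduct] using Finset.sum_le_sum fun y _ => le_abs_self (w y)
    linarith
  have := (hw ((∑ y, a y)⁻¹ • a)).1 ⟨by rw [Matrix.smul_vecMul, haA], by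
    rw [smul_dotProduct]
    simp [dotProduct, inv_mul_cancel₀ hpos.ne']⟩
  rw [← this]
  exact mul_nonneg (inv_nonneg.2 hpos.le) (abs_nonneg _)

variable [DecidableEq ι]

theorem fundamental_transpose_mulVec (h : ι → ℝ) :
    (Aᵀ - 1 + Matrix.vecMulVec 1 1)ᵀ *ᵥ h = A *ᵥ h - h + fun _ => ∑ x, h x := by
  rw [Matrix.transpose_add, Matrix.transpose_sub, Matrix.transpose_transpose, Matrix.transpose_one,
    Matrix.add_mulVec, Matrix.sub_mulVec, Matrix.one_mulVec]
  ext x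
  simp [Matrix.mulVec, dotProduct]

theorem fundamental_mulVec (w : ι → ℝ) :
    (Aᵀ - 1 + Matrix.vecMulVec 1 1) *ᵥ w = w ᵥ* A - w + fun _ => ∑ x, w x := by
  rw [Matrix.add_mulVec, Matrix.sub_mulVec, Matrix.one_mulVec, Matrix.mulVec_transpose]
  ext x
  simp [Matrix.mulVec, dotProduct]

/-- The transpose acts on functions, where the maximum principle applies. For `h` in its kernel, `A
h - h` is the constant `-∑ h`. Comparing at a maximum and at a minimum of `h` forces `∑ h = 0`; then
`h` is harmonic, hence constant, hence zero. -/
theorem isUnit_fundamental (h0 : ∀ x y, 0 ≤ A x y) (h1 : A *ᵥ 1 = 1)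
    (hr : ∀ x, Relation.ReflTransGen (fun a b => 0 < A a b) x x₀) :
    IsUnit (Aᵀ - 1 + Matrix.vecMulVec 1 1) := by
  rw [← Matrix.isUnit_transpose, ← Matrix.mulVec_injective_iff_isUnit]
  refine (injective_iff_map_eq_zero (Matrix.mulVecLin _)).2 fun h hh => ?_
  rw [Matrix.mulVecLin_apply, fundamental_transpose_mulVec] at hh
  have hx : ∀ x, (A *ᵥ h) x - h x + ∑ z, h z = 0 := fun x => congrFun hh x
  have : Nonempty ι := ⟨x₀⟩
  have hsum : ∀ x, ∑ z, A x z = 1 := fun x => by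
    simpa [Matrix.mulVec, dotProduct] using congrFun h1 x
  have hs : ∑ z, h z = 0 := by
    obtain ⟨a, ha⟩ := Finite.exists_max h
    obtain ⟨b, hb⟩ := Finite.exists_min h
    have h2 : (A *ᵥ h) a ≤ h a := by
      calc (A *ᵥ h) a ≤ ∑ z, A a z * h a :=
            Finset.sum_le_sum fun z _ => mul_le_mul_of_nonneg_left (ha z) (h0 a z)
        _ = h a := by rw [← Finset.sum_mul, hsum, one_mul]
    have h3 : h b ≤ (A *ᵥ h) b := by
      calc h b = ∑ z, A b z * h b := by rw [← Finset.sum_mul, hsum, one_mul]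
        _ ≤ (A *ᵥ h) b :=
            Finset.sum_le_sum fun z _ => mul_le_mul_of_nonneg_left (hb z) (h0 b z)
    linarith [hx a, hx b]
  have hc := eq_const_of_harmonic h0 h1 hr (h := h) (funext fun x => by linarith [hx x])
  have h4 : (Fintype.card ι : ℝ) * h x₀ = 0 := by
    rw [← hs, Finset.sum_congr rfl fun z _ => hc z]
    simp
  have h5 : h x₀ = 0 := (mul_eq_zero.1 h4).resolve_left (by simp)
  funext x
  rw [hc x, h5]
  rfl

theorem stationary_iff (h1 : A *ᵥ 1 = 1) [Nonempty ι]
    (hK : IsUnit (Aᵀ - 1 + Matrix.vecMulVec 1 1)) (w : ι → ℝ) :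
    (w ᵥ* A = w ∧ w ⬝ᵥ 1 = 1) ↔ w = (Aᵀ - 1 + Matrix.vecMulVec 1 1)⁻¹ *ᵥ 1 := by
  have hdet := (Matrix.isUnit_iff_isUnit_det _).1 hK
  constructor
  · rintro ⟨hw, hs⟩
    have : (Aᵀ - 1 + Matrix.vecMulVec 1 1) *ᵥ w = 1 := by
      rw [fundamental_mulVec, hw, sub_self, zero_add]
      funext x
      simpa [dotProduct] using hs
    have h2 := congrArg ((Aᵀ - 1 + Matrix.vecMulVec 1 1)⁻¹ *ᵥ ·) this
    simpa only [Matrix.mulVec_mulVec, Matrix.nonsing_inv_mul _ hdet, Matrix.one_mulVec] using h2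
  · intro hw
    have hw1 : (Aᵀ - 1 + Matrix.vecMulVec 1 1) *ᵥ w = 1 := by
      rw [hw, Matrix.mulVec_mulVec, Matrix.mul_nonsing_inv _ hdet, Matrix.one_mulVec]
    rw [fundamental_mulVec] at hw1
    have hx : ∀ x, (w ᵥ* A) x - w x + ∑ z, w z = 1 := fun x => congrFun hw1 x
    have htot : ∑ x, (w ᵥ* A) x = ∑ x, w x := by
      have := Matrix.dotProduct_mulVec w A 1
      rw [h1] at this
      simpa [dotProduct] using this.symm
    -- Sum the equation over all states: `A` preserves mass, so the first two terms cancel.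
    have hs : ∑ z, w z = 1 := by
      have h2 : ∑ x, ((w ᵥ* A) x - w x + ∑ z, w z) = ∑ _x : ι, (1 : ℝ) :=
        Finset.sum_congr rfl fun x _ => hx x
      rw [Finset.sum_add_distrib, Finset.sum_sub_distrib, htot, sub_self, zero_add] at h2
      simpa using h2
    refine ⟨funext fun x => by linarith [hx x], by simpa [dotProduct] using hs⟩

/-- Solvability of the Poisson equation. -/
theorem exists_poisson (hK : IsUnit (Aᵀ - 1 + Matrix.vecMulVec 1 1)) {w : ι → ℝ}
    (hw : w ᵥ* A = w) (hs : w ⬝ᵥ 1 = 1) (s : ι → ℝ) :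
    ∃ h : ι → ℝ, ∀ x, (A *ᵥ h) x - h x = s x - w ⬝ᵥ s := by
  have hdet := (Matrix.isUnit_iff_isUnit_det _).1 (Matrix.isUnit_transpose _ |>.2 hK)
  refine ⟨((Aᵀ - 1 + Matrix.vecMulVec 1 1)ᵀ)⁻¹ *ᵥ s, ?_⟩
  set h := ((Aᵀ - 1 + Matrix.vecMulVec 1 1)ᵀ)⁻¹ *ᵥ s with hh
  have hKh : (Aᵀ - 1 + Matrix.vecMulVec 1 1)ᵀ *ᵥ h = s := by
    rw [hh, Matrix.mulVec_mulVec, Matrix.mul_nonsing_inv _ hdet, Matrix.one_mulVec]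
  rw [fundamental_transpose_mulVec] at hKh
  -- Pairing the equation with the invariant vector `w` kills `A h - h` and identifies the constant.
  have hsum : ∑ z, h z = w ⬝ᵥ s := by
    have hc : (fun _ : ι => ∑ z, h z) = (∑ z, h z) • (1 : ι → ℝ) := by
      ext
      simp
    rw [← hKh, dotProduct_add, dotProduct_sub, Matrix.dotProduct_mulVec, hw, sub_self, zero_add,
      hc, dotProduct_smul, hs, smul_eq_mul, mul_one]
  intro x
  have : (A *ᵥ h) x - h x + ∑ z, h z = s x := congrFun hKh x
  linarith

end Finite

/-! ### The phase process: row sums and reachability -/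

section Phases

variable {N : ℕ} {α d u : ℝ} {p : Fin N → ℝ}

theorem phase_ext {x y : Phase N} (h1 : x.1.val = y.1.val) (h2 : x.2.val = y.2.val) : x = y := by
  obtain ⟨⟨n, hn⟩, ⟨i, hi⟩⟩ := x
  obtain ⟨⟨k, hk⟩, ⟨j, hj⟩⟩ := y
  simp only at h1 h2
  subst h1 h2
  rfl

theorem sum_phase_ite (a b : ℕ) (c : ℝ) :
    ∑ y : Phase N, (if y.1.val = a ∧ y.2.val = b then c else 0) =
      if a < N ∧ b ≤ a then c else 0 := by
  split_ifs with h
  · rw [Finset.sum_eq_single ⟨⟨a, h.1⟩, ⟨b, Nat.lt_succ_of_le h.2⟩⟩]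
    · simp
    · intro y _ hy
      exact if_neg fun hab => hy (phase_ext hab.1 hab.2)
    · simp
  · refine Finset.sum_eq_zero fun y _ => if_neg fun hab => h ?_
    have h1 := y.1.2
    have h2 := y.2.2
    omega

theorem T_apply (x y : Phase N) : T d p x y =
    (if y.1.val = x.1.val ∧ y.2.val = x.2.val then
      (if x.2.val = 0 then (1 - dec d x.1) * (1 - p x.1) else 1 - p x.1) else 0) +
    (if y.1.val = x.1.val ∧ y.2.val = x.2.val + 1 then p x.1 else 0) +
    (if y.1.val = x.1.val + 1 ∧ y.2.val = 0 then
      (if x.2.val = 0 then dec d x.1 * (1 - p x.1) else 0) else 0) := by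
  unfold T blockF blockD
  by_cases h1 : y.1.val = x.1.val
  · by_cases h2 : y.2.val = x.2.val
    · simp [h1, h2]
    · simp [h1, h2]
  · by_cases h2 : y.1.val = x.1.val + 1
    · by_cases h3 : x.2.val = 0 <;> by_cases h4 : y.2.val = 0 <;> simp [h2, h3, h4]
    · simp [h1, h2]

/-- At rate `0` the truncated subtraction makes the two target phases coincide; this is harmless
because `inc` vanishes there. -/
theorem S_apply (x y : Phase N) : S u p x y =
    (if y.1.val = x.1.val ∧ y.2.val = 0 then
      (if x.2.val = x.1.val then (1 - inc u x.1) * p x.1 else 0) else 0) +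
    (if y.1.val = x.1.val - 1 ∧ y.2.val = 0 then
      (if x.2.val = x.1.val then inc u x.1 * p x.1 else 0) else 0) := by
  unfold S blockM blockU inc
  by_cases h0 : 0 < x.1.val
  · split_ifs <;> first | omega | simp
  · simp only [h0, if_false, Nat.add_right_cancel_iff]
    split_ifs <;> first | omega | simp

theorem dec_mem (hd : 0 ≤ d) (hd1 : d ≤ 1) (n : Fin N) : 0 ≤ dec d n ∧ dec d n ≤ 1 := by
  unfold dec
  split_ifs <;> simp [*]

theorem inc_mem (hu : 0 ≤ u) (hu1 : u ≤ 1) (n : Fin N) : 0 ≤ inc u n ∧ inc u n ≤ 1 := by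
  unfold inc
  split_ifs <;> simp [*]

theorem T_nonneg (hd : 0 ≤ d) (hd1 : d ≤ 1) (hp : ∀ n, 0 < p n ∧ p n < 1) (x y : Phase N) :
    0 ≤ T d p x y := by
  obtain ⟨h1, h2⟩ := dec_mem hd hd1 x.1
  obtain ⟨h3, h4⟩ := hp x.1
  have h5 : 0 ≤ (1 - dec d x.1) * (1 - p x.1) := mul_nonneg (by linarith) (by linarith)
  have h6 : 0 ≤ dec d x.1 * (1 - p x.1) := mul_nonneg h1 (by linarith)
  rw [T_apply]
  refine add_nonneg (add_nonneg ?_ ?_) ?_ <;> split_ifs <;> linarith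

theorem S_nonneg (hu : 0 ≤ u) (hu1 : u ≤ 1) (hp : ∀ n, 0 < p n ∧ p n < 1) (x y : Phase N) :
    0 ≤ S u p x y := by
  obtain ⟨h1, h2⟩ := inc_mem hu hu1 x.1
  obtain ⟨h3, h4⟩ := hp x.1
  have h5 : 0 ≤ (1 - inc u x.1) * p x.1 := mul_nonneg (by linarith) h3.le
  have h6 : 0 ≤ inc u x.1 * p x.1 := mul_nonneg h1 h3.le
  rw [S_apply]
  refine add_nonneg ?_ ?_ <;> split_ifs <;> linarith

theorem S_eq_zero {x y : Phase N} (hy : y.2.val ≠ 0) : S u p x y = 0 := by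
  simp [S_apply, hy]

theorem sum_S_add_sum_T (x : Phase N) : ∑ y, S u p x y + ∑ y, T d p x y = 1 := by
  simp only [S_apply, T_apply, Finset.sum_add_distrib, sum_phase_ite]
  have h1 := x.1.2
  have h2 := x.2.2
  have h3 : x.1.val - 1 < N := by omega
  have h4 : x.2.val ≤ x.1.val := by omega
  unfold dec
  split_ifs <;> first | omega | ring

/-- A delivery always leads to a first fragment, so the boundary block `E` retains all nonzero
columns of `S`. -/
theorem sum_S_mul (f : Phase N → ℝ) (x : Phase N) :
    ∑ y, S u p x y * f y = ∑ n : Fin N, S u p x ⟨n, 0⟩ * f ⟨n, 0⟩ := by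
  rw [Fintype.sum_sigma]
  refine Finset.sum_congr rfl fun n _ => Finset.sum_eq_single 0 (fun j _ hj => ?_) (by simp)
  rw [S_eq_zero, zero_mul]
  exact fun h => hj (Fin.ext h)

theorem A_eq : A α d u p = S u p + T d p := by
  unfold A A0 A1 A2
  ext x y
  simp only [Matrix.add_apply, Matrix.smul_apply, smul_eq_mul]
  ring

/-- `y` is a possible successor of the phase `x`. -/
def PhaseStep (d u : ℝ) (p : Fin N → ℝ) (x y : Phase N) : Prop := 0 < (S u p + T d p) x y

theorem phaseStep_next (hu : 0 ≤ u) (hu1 : u ≤ 1)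
    (hp : ∀ n, 0 < p n ∧ p n < 1) {x y : Phase N} (h1 : y.1.val = x.1.val)
    (h2 : y.2.val = x.2.val + 1) : PhaseStep d u p x y := by
  refine add_pos_of_nonneg_of_pos (S_nonneg hu hu1 hp x y) ?_
  rw [T_apply]
  simpa [h1, h2] using (hp x.1).1

theorem phaseStep_dec (hd : 0 < d) (hu : 0 ≤ u) (hu1 : u ≤ 1)
    (hp : ∀ n, 0 < p n ∧ p n < 1) {x y : Phase N} (h1 : y.1.val = x.1.val + 1)
    (hx : x.2.val = 0) (hy : y.2.val = 0) : PhaseStep d u p x y := by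
  refine add_pos_of_nonneg_of_pos (S_nonneg hu hu1 hp x y) ?_
  have hN : x.1.val + 1 < N := h1 ▸ y.1.2
  rw [T_apply]
  simpa [h1, hx, hy, dec, hN, hd] using (hp x.1).2

theorem phaseStep_inc (hd : 0 ≤ d) (hd1 : d ≤ 1) (hu : 0 < u)
    (hp : ∀ n, 0 < p n ∧ p n < 1) {x y : Phase N} (h1 : y.1.val + 1 = x.1.val)
    (hx : x.2.val = x.1.val) (hy : y.2.val = 0) : PhaseStep d u p x y := by
  refine add_pos_of_pos_of_nonneg ?_ (T_nonneg hd hd1 hp x y)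
  have h2 : y.1.val = x.1.val - 1 := by omega
  have h3 : ¬ (x.1.val - 1 = x.1.val) := by omega
  have h4 : 0 < x.1.val := by omega
  rw [S_apply]
  simpa [h2, h3, hx, hy, inc, h4, hu] using (hp x.1).1

theorem phaseStep_same (hd : 0 ≤ d) (hd1 : d ≤ 1) (hu : 0 ≤ u) (hu1 : u ≤ 1)
    (hp : ∀ n, 0 < p n ∧ p n < 1) {x y : Phase N} (h1 : y.1.val = x.1.val)
    (hinc : inc u x.1 < 1) (hx : x.2.val = x.1.val) (hy : y.2.val = 0) : PhaseStep d u p x y := by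
  refine add_pos_of_pos_of_nonneg ?_ (T_nonneg hd hd1 hp x y)
  have h5 : 0 < (1 - inc u x.1) * p x.1 := mul_pos (by linarith) (hp x.1).1
  have h6 : 0 ≤ inc u x.1 * p x.1 := mul_nonneg (inc_mem hu hu1 _).1 (hp x.1).1.le
  rw [S_apply, if_pos ⟨h1, hy⟩, if_pos hx]
  refine add_pos_of_pos_of_nonneg h5 ?_
  split_ifs <;> linarith

theorem reaches_last_fragment (hu : 0 ≤ u) (hu1 : u ≤ 1)
    (hp : ∀ n, 0 < p n ∧ p n < 1) (x : Phase N) :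
    Relation.ReflTransGen (PhaseStep d u p) x ⟨x.1, Fin.last _⟩ := by
  obtain ⟨n, i⟩ := x
  induction i using Fin.reverseInduction with
  | last => exact .refl
  | cast i ih =>
    exact .head (phaseStep_next (y := ⟨n, i.succ⟩) hu hu1 hp rfl (by simp)) ih

theorem reaches_first_fragment (hd : 0 ≤ d) (hd1 : d ≤ 1) (hu : 0 ≤ u) (hu1 : u ≤ 1)
    (hp : ∀ n, 0 < p n ∧ p n < 1) (x : Phase N) :
    ∃ n : Fin N, Relation.ReflTransGen (PhaseStep d u p) x ⟨n, 0⟩ := by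
  have hl := reaches_last_fragment (d := d) hu hu1 hp x
  -- If the increment is certain, the packet cannot restart at the same rate, but then a higher rate
  -- exists.
  rcases (inc_mem hu hu1 x.1).2.lt_or_eq with h | h
  · exact ⟨x.1, hl.tail (phaseStep_same hd hd1 hu hu1 hp rfl h rfl rfl)⟩
  · have h0 : 0 < x.1.val := by
      by_contra h0
      simp [inc, h0] at h
    have hu0 : 0 < u := by
      simp only [inc, h0, if_true] at h
      linarith
    refine ⟨⟨x.1.val - 1, by omega⟩, hl.tail (phaseStep_inc hd hd1 hu0 hp ?_ rfl rfl)⟩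
    simp only
    omega

/-- Some phase at the start of a packet is reachable from every phase. -/
theorem exists_reachable_phase (hN : 1 ≤ N) (hd : 0 ≤ d) (hd1 : d ≤ 1) (hu : 0 ≤ u) (hu1 : u ≤ 1)
    (hdu : 2 ≤ N → 0 < d ∨ 0 < u) (hp : ∀ n, 0 < p n ∧ p n < 1) :
    ∃ x₀ : Phase N, ∀ x, Relation.ReflTransGen (PhaseStep d u p) x x₀ := by
  suffices h : ∃ x₀ : Phase N, ∀ n : Fin N, Relation.ReflTransGen (PhaseStep d u p) ⟨n, 0⟩ x₀ by
    obtain ⟨x₀, h⟩ := h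
    refine ⟨x₀, fun x => ?_⟩
    obtain ⟨n, hn⟩ := reaches_first_fragment hd hd1 hu hu1 hp x
    exact hn.trans (h n)
  obtain ⟨N, rfl⟩ : ∃ k, N = k + 1 := ⟨N - 1, by omega⟩
  -- With `d > 0` failures of first fragments lead down to the last rate; otherwise `u > 0` (or
  -- there is one rate) and deliveries lead up to the first. The phase chain need not be
  -- irreducible.
  by_cases hd0 : 0 < d
  · refine ⟨⟨Fin.last N, 0⟩, fun n => ?_⟩
    induction n using Fin.reverseInduction with
    | last => exact .refl
    | cast n ih => exact .head (phaseStep_dec hd0 hu hu1 hp (by simp) rfl rfl) ih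
  · refine ⟨⟨0, 0⟩, fun n => ?_⟩
    induction n using Fin.induction with
    | zero => exact .refl
    | succ n ih =>
      have hu0 : 0 < u := (hdu (by have := n.2; omega)).resolve_left hd0
      exact ((reaches_last_fragment hu hu1 hp ⟨n.succ, 0⟩).tail
        (phaseStep_inc hd hd1 hu0 hp (by simp) rfl rfl)).trans ih

end Phases

/-! ### The quasi-birth-death chain: drift of the potential, stability and instability -/

section Chain

variable {N : ℕ} {α d u : ℝ} {p : Fin N → ℝ}

theorem P_nonneg (hα : 0 ≤ α) (hα1 : α ≤ 1) (hd : 0 ≤ d) (hd1 : d ≤ 1) (hu : 0 ≤ u) (hu1 : u ≤ 1)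
    (hp : ∀ n, 0 < p n ∧ p n < 1) (a b : State N) : 0 ≤ P α d u p a b := by
  have hT := T_nonneg hd hd1 hp
  have hS := S_nonneg hu hu1 hp
  have hα' : 0 ≤ 1 - α := by linarith
  rcases a with n | ⟨k, x⟩ <;> rcases b with n' | ⟨l, y⟩
  · simp only [P, Matrix.smul_apply, smul_eq_mul, Matrix.one_apply]
    split_ifs <;> simp [hα']
  · simp only [P, C, Matrix.smul_apply, smul_eq_mul]
    split_ifs <;> simp [hα]
  · simp only [P, E, Matrix.smul_apply, smul_eq_mul]
    split_ifs
    · exact mul_nonneg hα' (hS _ _)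
    · exact le_rfl
  · simp only [P, A0, A1, A2, Matrix.smul_apply, Matrix.add_apply, smul_eq_mul]
    have h1 := mul_nonneg hα (hT x y)
    have h2 := mul_nonneg hα (hS x y)
    have h3 := mul_nonneg hα' (hT x y)
    have h4 := mul_nonneg hα' (hS x y)
    split_ifs <;> linarith

theorem hasSum_P_idle (g : State N → ℝ) (n : Fin N) :
    HasSum (fun z => P α d u p (.idle n) z * g z)
      ((1 - α) * g (.idle n) + α * g (.busy 0 ⟨n, 0⟩)) := by
  classical
  convert (hasSum_ite_eq (State.idle n) ((1 - α) * g (.idle n))).add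
    (hasSum_ite_eq (State.busy 0 ⟨n, 0⟩) (α * g (.busy 0 ⟨n, 0⟩))) using 2 with z
  rcases z with n' | ⟨l, y⟩
  · by_cases h : n = n'
    · subst h
      simp [P]
    · simp [P, h, Ne.symm h]
  · by_cases h : l = 0 ∧ y = ⟨n, 0⟩
    · obtain ⟨rfl, rfl⟩ := h
      simp [P, C]
    · have h2 : ¬ (l = 0 ∧ y.1 = n ∧ y.2.val = 0) := by
        rintro ⟨rfl, rfl, h0⟩
        exact h ⟨rfl, phase_ext rfl h0⟩
      by_cases hl : l = 0
      · simp only [hl, true_and] at h h2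
        simp only [P, C, hl, if_true, Matrix.smul_apply, if_neg h2]
        simp [h]
      · simp [P, hl]

theorem sum_busy_ite [DecidableEq (State N)] (c : Phase N → ℝ) (g : State N → ℝ) (j : ℕ)
    (z : State N) :
    ∑ y, (if z = .busy j y then c y * g (.busy j y) else 0) =
      match z with
      | .idle _ => 0
      | .busy l y => if l = j then c y * g (.busy l y) else 0 := by
  rcases z with n | ⟨l, y⟩
  · simp
  · by_cases h : l = j
    · subst h
      simp
    · simp [h]

theorem hasSum_P_busy_zero (g : State N → ℝ) (x : Phase N) :
    HasSum (fun z => P α d u p (.busy 0 x) z * g z)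
      (∑ y, A0 α d p x y * g (.busy 1 y) + ∑ y, A1 α d u p x y * g (.busy 0 y) +
        ∑ n, ((1 - α) * S u p x ⟨n, 0⟩) * g (.idle n)) := by
  classical
  convert ((hasSum_sum fun y (_ : y ∈ Finset.univ) =>
      hasSum_ite_eq (State.busy 1 y) (A0 α d p x y * g (.busy 1 y))).add
    (hasSum_sum fun y (_ : y ∈ Finset.univ) =>
      hasSum_ite_eq (State.busy 0 y) (A1 α d u p x y * g (.busy 0 y)))).add
    (hasSum_sum fun n (_ : n ∈ Finset.univ) =>
      hasSum_ite_eq (State.idle n) (((1 - α) * S u p x ⟨n, 0⟩) * g (.idle n))) using 2 with z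
  rw [sum_busy_ite, sum_busy_ite]
  rcases z with n' | ⟨l, y⟩
  · simp [P, E]
  · rcases l with _ | _ | l <;> simp [P]

theorem hasSum_P_busy_succ (g : State N → ℝ) (k : ℕ) (x : Phase N) :
    HasSum (fun z => P α d u p (.busy (k + 1) x) z * g z)
      (∑ y, A0 α d p x y * g (.busy (k + 2) y) + ∑ y, A1 α d u p x y * g (.busy (k + 1) y) +
        ∑ y, A2 α u p x y * g (.busy k y)) := by
  classical
  convert ((hasSum_sum fun y (_ : y ∈ Finset.univ) =>
      hasSum_ite_eq (State.busy (k + 2) y) (A0 α d p x y * g (.busy (k + 2) y))).add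
    (hasSum_sum fun y (_ : y ∈ Finset.univ) =>
      hasSum_ite_eq (State.busy (k + 1) y) (A1 α d u p x y * g (.busy (k + 1) y)))).add
    (hasSum_sum fun y (_ : y ∈ Finset.univ) =>
      hasSum_ite_eq (State.busy k y) (A2 α u p x y * g (.busy k y))) using 2 with z
  rw [sum_busy_ite, sum_busy_ite, sum_busy_ite]
  rcases z with n' | ⟨l, y⟩
  · simp [P]
  · by_cases h1 : l = k + 2
    · simp [P, h1]
    · by_cases h2 : l = k + 1
      · simp [P, h2]
      · by_cases h3 : l = k
        · subst h3
          have h4 : ¬ (l = l + 1 + 1) := by omega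
          simp [P, h4]
        · simp [P, h1, h2, h3]

/-- The number of packets in the buffer plus a function of the phase. -/
def potential (h : Phase N → ℝ) : State N → ℝ
  | .idle n => h ⟨n, 0⟩
  | .busy k x => k + 1 + h x

/-- The mean of the potential after one step. -/
noncomputable def meanPotential (α d u : ℝ) (p : Fin N → ℝ) (h : Phase N → ℝ) : State N → ℝ
  | .idle n => h ⟨n, 0⟩ + α
  | .busy k x => k + 1 + ((S u p + T d p) *ᵥ h) x + (α - (S u p *ᵥ 1) x)

/-- The mean change of the packet count in a busy state is `α T e - (1 - α) S e = α - S e`. Level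
zero obeys the same formula: an idle state has the potential of its first-fragment phase with zero
packets, and `S` only leads to such phases. -/
theorem hasSum_potential (h : Phase N → ℝ) (a : State N) :
    HasSum (fun z => P α d u p a z * potential h z) (meanPotential α d u p h a) := by
  -- Here `r` is the current number of packets, that is `k + 1` in `busy k x`.
  have hmix : ∀ (x : Phase N) (r : ℝ),
      ∑ y, A0 α d p x y * (r + 1 + h y) + ∑ y, A1 α d u p x y * (r + h y) +
        ∑ y, A2 α u p x y * (r - 1 + h y) =
      r + ((S u p + T d p) *ᵥ h) x + (α - (S u p *ᵥ 1) x) := by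
    intro x r
    have h1 := sum_S_add_sum_T (d := d) (u := u) (p := p) x
    have h2 : ((S u p + T d p) *ᵥ h) x = ∑ y, S u p x y * h y + ∑ y, T d p x y * h y := by
      rw [Matrix.add_mulVec]
      rfl
    have h3 : (S u p *ᵥ 1) x = ∑ y, S u p x y := by simp [Matrix.mulVec, dotProduct]
    have h4 : ∑ y, T d p x y = 1 - ∑ y, S u p x y := by linarith
    simp only [A0, A1, A2, Matrix.add_apply, Matrix.smul_apply, smul_eq_mul, mul_add, add_mul,
      Finset.sum_add_distrib, ← Finset.sum_mul, mul_assoc, ← Finset.mul_sum, h2, h3, h4]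
    ring
  rcases a with n | ⟨k, x⟩
  · convert hasSum_P_idle (potential h) n using 1
    simp only [meanPotential, potential]
    push_cast
    ring
  · rcases k with _ | k
    · convert hasSum_P_busy_zero (potential h) x using 1
      have h5 : ∑ n, ((1 - α) * S u p x ⟨n, 0⟩) * potential h (.idle n) =
          ∑ y, A2 α u p x y * ((1 : ℝ) - 1 + h y) := by
        simp only [A2, Matrix.smul_apply, smul_eq_mul, mul_assoc, ← Finset.mul_sum, sum_S_mul]
        simp [potential]
      rw [h5, meanPotential, Nat.cast_zero, zero_add, ← hmix]
      simp [potential]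
    · convert hasSum_P_busy_succ (potential h) k x using 1
      rw [meanPotential, ← hmix]
      simp only [potential]
      push_cast
      congr 1
      · congr 1
        exact Finset.sum_congr rfl fun y _ => by ring
      · exact Finset.sum_congr rfl fun y _ => by ring

theorem hasSum_P (a : State N) : HasSum (P α d u p a) 1 := by
  rcases a with n | ⟨k, x⟩
  · simpa using hasSum_P_idle (α := α) (d := d) (u := u) (p := p) 1 n
  · have h1 := sum_S_add_sum_T (d := d) (u := u) (p := p) x
    rcases k with _ | k
    · convert hasSum_P_busy_zero (α := α) (d := d) (u := u) (p := p) 1 x using 1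
      · simp
      · have := sum_S_mul (u := u) (p := p) 1 x
        simp only [Pi.one_apply, mul_one] at this
        simp only [A0, A1, Matrix.add_apply, Matrix.smul_apply, smul_eq_mul, Pi.one_apply, mul_one,
          Finset.sum_add_distrib, ← Finset.mul_sum, ← this]
        linear_combination -h1
    · convert hasSum_P_busy_succ (α := α) (d := d) (u := u) (p := p) 1 k x using 1
      · simp
      · simp only [A0, A1, A2, Matrix.add_apply, Matrix.smul_apply, smul_eq_mul, Pi.one_apply,
          mul_one, Finset.sum_add_distrib, ← Finset.mul_sum]
        linear_combination -h1

theorem sub_le_two_mul_sum_abs (h : Phase N → ℝ) (x y : Phase N) : h x - h y ≤ 2 * ∑ z, |h z| := by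
  have h1 := Finset.single_le_sum (f := fun z => |h z|) (fun z _ => abs_nonneg _)
    (Finset.mem_univ x)
  have h2 := Finset.single_le_sum (f := fun z => |h z|) (fun z _ => abs_nonneg _)
    (Finset.mem_univ y)
  linarith [le_abs_self (h x), neg_abs_le (h y)]

theorem potential_le_of_pos (h : Phase N → ℝ) {a b : State N} (hab : 0 < P α d u p a b) :
    potential h b ≤ potential h a + (1 + 2 * ∑ z, |h z|) := by
  rcases a with n | ⟨k, x⟩ <;> rcases b with n' | ⟨l, y⟩ <;> simp only [potential]
  · linarith [sub_le_two_mul_sum_abs h ⟨n', 0⟩ ⟨n, 0⟩]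
  · have hl : l = 0 := by
      by_contra hl
      simp [P, hl] at hab
    subst hl
    have := sub_le_two_mul_sum_abs h y ⟨n, 0⟩
    push_cast
    linarith
  · have : (0 : ℝ) ≤ k := k.cast_nonneg
    linarith [sub_le_two_mul_sum_abs h ⟨n', 0⟩ x]
  · have hl : l ≤ k + 1 := by
      by_contra hl
      have h1 : ¬ (l = k + 1) := by omega
      have h2 : ¬ (l = k) := by omega
      have h3 : ¬ (l + 1 = k) := by omega
      simp [P, h1, h2, h3] at hab
    have hl' : (l : ℝ) ≤ k + 1 := by exact_mod_cast hl
    linarith [sub_le_two_mul_sum_abs h y x]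

/-- The Poisson equation replaces the phase-dependent drift `α - S e` by the constant `α - c`. -/
theorem meanPotential_busy {h : Phase N → ℝ} {c : ℝ}
    (hh : ∀ x, ((S u p + T d p) *ᵥ h) x - h x = (S u p *ᵥ 1) x - c) (k : ℕ) (x : Phase N) :
    meanPotential α d u p h (.busy k x) = potential h (.busy k x) + (α - c) := by
  simp only [meanPotential, potential]
  linarith [hh x]

theorem not_stable_of_le (hα : 0 ≤ α) (hα1 : α ≤ 1) (hd : 0 ≤ d) (hd1 : d ≤ 1) (hu : 0 ≤ u)
    (hu1 : u ≤ 1) (hp : ∀ n, 0 < p n ∧ p n < 1) {h : Phase N → ℝ} {c : ℝ}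
    (hh : ∀ x, ((S u p + T d p) *ᵥ h) x - h x = (S u p *ᵥ 1) x - c) (hc : c ≤ α)
    (hN : Nonempty (Phase N)) : ¬ Stable (P α d u p) := by
  rintro ⟨a, -, ha⟩
  obtain ⟨x⟩ := hN
  -- Optional stopping bounds the potential at every level by its value at the target `a`, which is
  -- absurd for large `k`.
  have key : ∀ k : ℕ, (k : ℝ) + 1 + h x ≤ potential h a := fun k =>
    le_of_subharmonic (P_nonneg hα hα1 hd hd1 hu hu1 hp) hasSum_P
      (fun _ _ => potential_le_of_pos h) (hasSum_potential h) (fun b => by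
        rcases b with n | ⟨k, x⟩
        · simp only [meanPotential, potential]
          linarith
        · rw [meanPotential_busy hh]
          linarith) (ha (.busy k x))
  obtain ⟨k, hk⟩ := exists_nat_gt (potential h a - h x)
  linarith [key k]

theorem stable_of_lt (hα : 0 < α) (hα1 : α < 1) (hd : 0 ≤ d) (hd1 : d ≤ 1) (hu : 0 ≤ u)
    (hu1 : u ≤ 1) (hp : ∀ n, 0 < p n ∧ p n < 1) {h : Phase N → ℝ} {c : ℝ}
    (hh : ∀ x, ((S u p + T d p) *ᵥ h) x - h x = (S u p *ᵥ 1) x - c) (hc : α < c)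
    {x₀ : Phase N} (hr : ∀ x, Relation.ReflTransGen (PhaseStep d u p) x x₀) :
    Stable (P α d u p) := by
  classical
  suffices hall : ∀ a, FiniteMeanPassage (P α d u p) a (.busy 0 x₀) from ⟨_, hall _, hall⟩
  have h0 := P_nonneg hα.le hα1.le hd hd1 hu hu1 hp
  -- `S + T` fixes constants, so a solution can be shifted to be nonnegative, as a Lyapunov function
  -- in `ℝ≥0∞` requires.
  obtain ⟨h', hh', hnn⟩ : ∃ h' : Phase N → ℝ,
      (∀ x, ((S u p + T d p) *ᵥ h') x - h' x = (S u p *ᵥ 1) x - c) ∧ ∀ x, 0 ≤ h' x := by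
    refine ⟨h + (∑ z, |h z|) • 1, fun x => ?_, fun x => ?_⟩
    · have h1 : (S u p + T d p) *ᵥ (1 : Phase N → ℝ) = 1 := by
        funext x
        rw [Matrix.add_mulVec]
        simpa [Matrix.mulVec, dotProduct] using sum_S_add_sum_T (d := d) (u := u) (p := p) x
      rw [Matrix.mulVec_add, Matrix.mulVec_smul, h1, ← hh x]
      simp
    · have := Finset.single_le_sum (f := fun z => |h z|) (fun z _ => abs_nonneg _)
        (Finset.mem_univ x)
      simp only [Pi.add_apply, Pi.smul_apply, Pi.one_apply, smul_eq_mul, mul_one]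
      linarith [neg_abs_le (h x)]
  have hpn : ∀ a, 0 ≤ potential h' a := by
    rintro (n | ⟨k, x⟩)
    · exact hnn _
    · simp only [potential]
      have := hnn x
      positivity
  have hmean : ∀ a, ∑' z, ENNReal.ofReal (P α d u p a z) * ENNReal.ofReal (potential h' z) =
      ENNReal.ofReal (meanPotential α d u p h' a) := by
    intro a
    have hs := hasSum_potential (α := α) (d := d) (u := u) (p := p) h' a
    rw [← hs.tsum_eq, ENNReal.ofReal_tsum_of_nonneg
      (fun z => mul_nonneg (h0 a z) (hpn z)) hs.summable]
    exact tsum_congr fun z => (ENNReal.ofReal_mul (h0 a z)).symm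
  have hmn : ∀ a, 0 ≤ meanPotential α d u p h' a := fun a =>
    (hasSum_potential h' a).nonneg fun z => mul_nonneg (h0 a z) (hpn z)
  -- As `0 < α < 1`, every phase step can occur without changing the level: a failure to deliver
  -- without an arrival, or a delivery with one.
  have hstep : ∀ x y, PhaseStep d u p x y → 0 < P α d u p (.busy 0 x) (.busy 0 y) := by
    intro x y hxy
    have hT := T_nonneg hd hd1 hp x y
    have hS := S_nonneg hu hu1 hp x y
    have hα' : 0 < 1 - α := by linarith
    simp only [PhaseStep, Matrix.add_apply] at hxy
    simp only [P, A1, Matrix.add_apply, Matrix.smul_apply, smul_eq_mul]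
    norm_num
    rcases hT.lt_or_eq with h1 | h1
    · exact add_pos_of_pos_of_nonneg (mul_pos hα' h1) (mul_nonneg hα.le hS)
    · rw [← h1] at hxy ⊢
      have : 0 < S u p x y := by linarith
      have := mul_pos hα this
      linarith
  intro a
  refine finiteMeanPassage_of_drift (tsum_ofReal_eq_one h0 hasSum_P)
    (V := fun z => ENNReal.ofReal (potential h' z)) (fun _ => ENNReal.ofReal_ne_top)
    -- The idle drift is `α = c - (c - α)`, so `b = c` gives equality there.
    (ε := ENNReal.ofReal (c - α)) (b := ENNReal.ofReal c)
    (ENNReal.ofReal_pos.2 (by linarith)).ne' ENNReal.ofReal_ne_top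
    (Finset.univ.image State.idle) ?_ ?_ ?_ a
  · intro b hb
    obtain ⟨n, -, rfl⟩ := Finset.mem_image.1 hb
    refine exists_firstPassage_ne_zero (Relation.TransGen.head' (b := .busy 0 ⟨n, 0⟩) ?_ ?_)
    · simpa [P, C] using hα
    · exact Relation.ReflTransGen.lift (State.busy 0) hstep _ _ (hr ⟨n, 0⟩)
  · intro b hb
    obtain ⟨n, -, rfl⟩ := Finset.mem_image.1 hb
    rw [hmean, ← ENNReal.ofReal_add (hmn _) (by linarith),
      ← ENNReal.ofReal_add (hpn _) (by linarith)]
    refine ENNReal.ofReal_le_ofReal (le_of_eq ?_)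
    simp only [meanPotential, potential]
    ring
  · intro b hb
    rcases b with n | ⟨k, x⟩
    · simp at hb
    · rw [hmean, ← ENNReal.ofReal_add (hmn _) (by linarith), meanPotential_busy hh']
      refine ENNReal.ofReal_le_ofReal (le_of_eq ?_)
      ring

end Chain

end RateQBD

theorem lemma2 {N M : ℕ} (hN : 1 ≤ N) (α d u : ℝ) (p : Fin M → Fin N → ℝ) (m : Fin M)
    (hα : 0 < α) (hα1 : α ≤ 1)
    (hd : 0 ≤ d) (hd1 : d ≤ 1) (hu : 0 ≤ u) (hu1 : u ≤ 1) (hdu : 2 ≤ N → 0 < d ∨ 0 < u)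
    (hp : ∀ n, 0 < p m n ∧ p m n < 1) :
    -- the inverse in the definition of the vector exists
    IsUnit (RateQBD.K d u (p m)) ∧
    -- the vector is the stationary vector of the phase process
    (∀ x, 0 ≤ RateQBD.stat d u (p m) x) ∧
    (∀ w : RateQBD.Phase N → ℝ,
      (w ᵥ* RateQBD.A α d u (p m) = w ∧ w ⬝ᵥ 1 = 1) ↔ w = RateQBD.stat d u (p m)) ∧
    -- the stability criterion
    (RateQBD.Stable (RateQBD.P α d u (p m)) ↔
      (1 - α) * (RateQBD.stat d u (p m) ⬝ᵥ (RateQBD.S u (p m) *ᵥ 1)) >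
        α * (RateQBD.stat d u (p m) ⬝ᵥ (RateQBD.T d (p m) *ᵥ 1))) := by
  open RateQBD in
  have h0 : ∀ x y, 0 ≤ (S u (p m) + T d (p m)) x y := fun x y =>
    add_nonneg (S_nonneg hu hu1 hp x y) (T_nonneg hd hd1 hp x y)
  have h1 : (S u (p m) + T d (p m)) *ᵥ 1 = 1 := by
    funext x
    rw [Matrix.add_mulVec]
    simpa [Matrix.mulVec, dotProduct] using sum_S_add_sum_T (d := d) (u := u) (p := p m) x
  obtain ⟨x₀, hr⟩ := exists_reachable_phase hN hd hd1 hu hu1 hdu hp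
  have hne : Nonempty (Phase N) := ⟨x₀⟩
  have hK : IsUnit (K d u (p m)) := isUnit_fundamental h0 h1 hr
  have hstat : ∀ w : Phase N → ℝ,
      (w ᵥ* (S u (p m) + T d (p m)) = w ∧ w ⬝ᵥ 1 = 1) ↔ w = stat d u (p m) :=
    stationary_iff h1 hK
  have hnn := stationary_nonneg h0 h1 hstat
  refine ⟨hK, hnn, fun w => by rw [A_eq, hstat], ?_⟩
  obtain ⟨hw, hs⟩ := (hstat _).2 rfl
  obtain ⟨h, hh⟩ := exists_poisson hK hw hs (S u (p m) *ᵥ 1)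
  set c := stat d u (p m) ⬝ᵥ (S u (p m) *ᵥ 1) with hc
  have hT : stat d u (p m) ⬝ᵥ (T d (p m) *ᵥ 1) = 1 - c := by
    have := congrArg (stat d u (p m) ⬝ᵥ ·) h1
    simp only [Matrix.add_mulVec, dotProduct_add, hs] at this
    linarith
  -- Thus `α < c` entails `α < 1`, which `stable_of_lt` needs; for `α = 1` the chain is unstable.
  have hc1 : c ≤ 1 := by
    have : 0 ≤ stat d u (p m) ⬝ᵥ (T d (p m) *ᵥ 1) :=
      Finset.sum_nonneg fun x _ => mul_nonneg (hnn x) <|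
        Finset.sum_nonneg fun y _ => mul_nonneg (T_nonneg hd hd1 hp x y) zero_le_one
    linarith
  rw [hT]
  constructor
  · intro hst
    by_contra hle
    exact not_stable_of_le hα.le hα1 hd hd1 hu hu1 hp hh (by linarith) hne hst
  · intro hlt
    have hlt' : α < c := by linarith
    exact stable_of_lt hα (by linarith) hd hd1 hu hu1 hp hh hlt' hr
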